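/- **Setting.** Let $\mathcal X$ be an infinite-dimensional separable real Hilbert space. Let $\mathcal C_0$ be a self-adjoint, positive-definite, trace class operator on $\mathcal X$ with orthonormal eigenbasis $(\phi_k)_{k\in\mathbb N}$. For $t\in\mathbb R$ let $\|u\|_t=\|\mathcal C_0^{-t/2}u\|$ and let $X^t$ be the associated Hilbert scale, that is, the completion of $\bigcap_{l\ge 0}\mathcal D(\mathcal C_0^{-l})$ in $\|\cdot\|_t$ (identified with the space of sequences of coefficients in $(\phi_k)$ for which this norm is finite; put $\|u\|_t=\infty$ for $u\notin X^t$). Let $\mathcal C_1$ be a bounded, self-adjoint, positive-definite operator on $\mathcal X$, and let $\mathcal A$ be a self-adjoint, positive-definite (generally unbounded) operator in $\mathcal X$ with bounded inverse $\mathcal A^{-1}$. **Assumptions.** There are $s_0\in[0,1)$, $\beta\ge 0$, $\ell\ge 0$ and positive constants $c,c',c_1,\dots,c_4$ such that 1. $\mathcal C_0^s$ is trace class for all $s>s_0$; 2. $\Delta:=2\ell-\beta+1>2s_0$; 3. $c\,\|u\|_{\beta-2\ell}\le\|\mathcal C_1^{-1/2}\mathcal A^{-1}u\|\le c'\|u\|_{\beta-2\ell}$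 for all $u\in X^{\beta-2\ell}$; 4. $\|\mathcal C_1^{1/2}u\|_{\rho}\le c_1\|u\|_{\rho-\beta}$ for all $u\in X^{\rho-\beta}$ and all $\rho\in[\lceil\beta-s_0-1\rceil,\beta-s_0)$; 5. $\|\mathcal C_1^{-1/2}u\|_{-s}\le c_2\|u\|_{\beta-s}$ for all $u\in X^{\beta-s}$ and all $s\in(s_0,1]$; 6. $\|\mathcal C_1^{-1/2}\mathcal A^{-1}u\|_{s}\le c_3\|u\|_{s+\beta-2\ell}$ for all $u\in X^{s+\beta-2\ell}$ and all $s\in(s_0,1]$; 7. $\|\mathcal A^{-1}\mathcal C_1^{-1}u\|_{-\eta}\le c_4\|u\|_{2\beta-2\ell-\eta}$ for all $u\in X^{2\beta-2\ell-\eta}$ and all $\eta\in[\beta-2\ell,1]$. Here an operator applied to an element outside its natural domain in $\mathcal X$ means its extension by continuity between the spaces of the scale in question; in 3, 4 and 6 the elements of $\mathcal X\cap X^t$ ($X^t$ the space named there) belong to the natural domain, and in 5 and 7 the natural domain (intersected with $X^t$) is dense in $X^t$. **Data and posterior mean.** Let $\xi\sim\mathcal N(0,\mathcal C_1)$ be a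 (generalized) Gaussian random element, i.e. its coordinates $\langle\xi,\phi_k\rangle$ are random variables such that $\langle \xi,h\rangle\sim N(0,\langle\mathcal C_1h,h\rangle)$ for every finite linear combination $h$ of the $\phi_k$. Let $u^\dagger\in X^1$ and, for $n>0$, $y^\dagger=\mathcal A^{-1}u^\dagger+n^{-1/2}\xi$. For $\lambda>0$ let $m^\dagger_\lambda\in X^1$ be the weak solution of $(\mathcal A^{-1}\mathcal C_1^{-1}\mathcal A^{-1}+\lambda\mathcal C_0^{-1})m^\dagger_\lambda=\mathcal A^{-1}\mathcal C_1^{-1}y^\dagger$, i.e. $$\langle\mathcal C_1^{-1/2}\mathcal A^{-1}m^\dagger_\lambda,\mathcal C_1^{-1/2}\mathcal A^{-1}v\rangle+\lambda\langle\mathcal C_0^{-1/2}m^\dagger_\lambda,\mathcal C_0^{-1/2}v\rangle=\langle\mathcal A^{-1}\mathcal C_1^{-1}y^\dagger,v\rangle\qquad\text{for all }v\in X^1,$$ where $\mathcal A^{-1}\mathcal C_1^{-1}y^\dagger\in X^{-1}$ and the right-hand side is the duality pairing of $X^{-1}$ and $X^1$. **Theorem.** For $\theta\in[0,1]$ put $\eta(\theta)=(1-\theta)(\beta-2\ell)+\theta$.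 Let $\theta_1,\theta_2\in[0,1]$ be such that $\mathbb E(\kappa^2)<\infty$, where $$\kappa=\max\{\|\xi\|_{2\beta-2\ell-\eta(\theta_1)},\ \|u^\dagger\|_{2-\eta(\theta_2)}\},$$ and let $$\tau(n)=n^{\frac{\theta_2-\theta_1-1}{2(\theta_1-\theta_2+2)}},\qquad \lambda=\lambda(n)=\frac1{n\,\tau(n)^2}.$$ Then for every $n>0$ the weak solution $m^\dagger_\lambda$ exists and is unique almost surely and is a random element of $\mathcal X$ (measurable up to null sets), and there is a constant $c>0$, independent of $n$ and $\theta$, such that for all $n>0$ and all $\theta\in[0,1]$ $$\mathbb E\,\|m^\dagger_\lambda-u^\dagger\|_{\eta(\theta)}^2\le c\,n^{\frac{\theta+\theta_2-2}{\theta_1-\theta_2+2}}.$$ -/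

import Mathlib

open MeasureTheory ProbabilityTheory Filter Topology
open scoped NNReal ENNReal InnerProductSpace

noncomputable section

namespace BayesInv

/-- The operators of the linear inverse problem `y = A⁻¹ u + n^{-1/2} ξ` on a separable
infinite-dimensional real Hilbert space `H`: the prior covariance `C₀`, the noise covariance `C₁`,
and the (generally unbounded) forward operator `A` with bounded inverse. -/
structure Model (H : Type*) [NormedAddCommGroup H] [InnerProductSpace ℝ H] [CompleteSpace H] where
  /-- the prior covariance, self-adjoint, positive definite -/
  C₀ : H →L[ℝ] H
  C₀_selfAdjoint : IsSelfAdjoint C₀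
  C₀_pos : ∀ x, x ≠ 0 → 0 < ⟪C₀ x, x⟫_ℝ
  /-- an orthonormal eigenbasis of `C₀` (countably infinite) with its eigenvalues -/
  φ : HilbertBasis ℕ ℝ H
  σ : ℕ → ℝ
  eigen : ∀ k, C₀ (φ k) = σ k • φ k
  /-- `C₀` is trace class -/
  C₀_trace : Summable σ
  /-- the noise covariance, bounded, self-adjoint, positive definite -/
  C₁ : H →L[ℝ] H
  C₁_selfAdjoint : IsSelfAdjoint C₁
  C₁_pos : ∀ x, x ≠ 0 → 0 < ⟪C₁ x, x⟫_ℝ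
  /-- `R = C₁^{1/2}`, the (unique) positive square root of `C₁` -/
  R : H →L[ℝ] H
  R_pos : R.IsPositive
  R_sq : R ∘L R = C₁
  /-- the forward operator: self-adjoint (hence densely defined), positive definite -/
  A : H →ₗ.[ℝ] H
  A_selfAdjoint : IsSelfAdjoint A
  A_pos : ∀ x : A.domain, (x : H) ≠ 0 → 0 < ⟪A x, (x : H)⟫_ℝ
  /-- its bounded inverse `A⁻¹` -/
  Ainv : H →L[ℝ] H
  A_Ainv : ∀ x, ∃ h : Ainv x ∈ A.domain, A ⟨Ainv x, h⟩ = x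
  Ainv_A : ∀ x : A.domain, Ainv (A x) = x

variable {H : Type*} [NormedAddCommGroup H] [InnerProductSpace ℝ H] [CompleteSpace H]

namespace Model

/-! ### The Hilbert scale

Elements of all the spaces `X^t`, `t ∈ ℝ`, are represented by their coefficient sequences in the
eigenbasis `φ`: the completion of `⋂ D(C₀^{-l})` in the norm `‖C₀^{-t/2} ·‖` is the space of all
sequences for which that norm is finite. -/

/-- The coefficients `⟨u, φ_k⟩` of `u ∈ H`. -/
def coeff (D : Model H) (u : H) : ℕ → ℝ := fun k => ⟪D.φ k, u⟫_ℝ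

/-- The power `C₀^t`, acting on coefficient sequences. -/
def pow (D : Model H) (t : ℝ) (a : ℕ → ℝ) : ℕ → ℝ := fun k => D.σ k ^ t * a k

/-- The norm `‖a‖_t = ‖C₀^{-t/2} a‖`, with value `∞` if `a ∉ X^t`. -/
def scaleNorm (D : Model H) (t : ℝ) (a : ℕ → ℝ) : ℝ≥0∞ :=
  (∑' k, ‖D.pow (-t / 2) a k‖ₑ ^ 2) ^ (1 / 2 : ℝ)

/-- `a ∈ X^t`. -/
def MemX (D : Model H) (t : ℝ) (a : ℕ → ℝ) : Prop := D.scaleNorm t a < ∞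

end Model

/-- The pairing `∑ a_k b_k`: the duality between `X^{-t}` and `X^t`, extending the inner product
of `H`. The series converges absolutely for `a ∈ X^{-t}`, `b ∈ X^t`. -/
def pairing (a b : ℕ → ℝ) : ℝ := ∑' k, a k * b k

namespace Model

/-! ### Operators between spaces of the scale

A partially defined operator `T` in `H` is given by its graph: `G u w` means that `u` belongs to
the domain of `T` and `T u = w`. -/

/-- The graph of `C₁^{-1/2}`. -/
def graphInvSqrt (D : Model H) (u w : H) : Prop := D.R w = u

/-- The graph of `C₁^{-1/2} A⁻¹`. -/
def graphInvSqrtAinv (D : Model H) (u w : H) : Prop := D.R w = D.Ainv u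

/-- The graph of `A⁻¹ C₁⁻¹`. -/
def graphAinvInv (D : Model H) (u w : H) : Prop := ∃ z, D.C₁ z = u ∧ D.Ainv z = w

/-- The operator with graph `G` is defined on `H ∩ X^p` and maps it to `X^q`, with
`‖T u‖_q ≤ c ‖u‖_p`. -/
def MapsBoundedly (D : Model H) (G : H → H → Prop) (p q : ℝ) (c : ℝ≥0) : Prop :=
  ∀ u, D.MemX p (D.coeff u) →
    ∃ w, G u w ∧ D.scaleNorm q (D.coeff w) ≤ c * D.scaleNorm p (D.coeff u)

/-- The operator `T` with graph `G` extends by continuity to a bounded operator `X^p → X^q` of norm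
at most `c`: it is densely defined in `X^p`, and `‖T u‖_q ≤ c ‖u‖_p` on its domain. -/
def ExtendsBoundedly (D : Model H) (G : H → H → Prop) (p q : ℝ) (c : ℝ≥0) : Prop :=
  (∀ a, D.MemX p a → ∀ ε : ℝ≥0∞, 0 < ε → ∃ u w, G u w ∧ D.scaleNorm p (a - D.coeff u) < ε) ∧
  ∀ u w, G u w → D.MemX p (D.coeff u) →
    D.scaleNorm q (D.coeff w) ≤ c * D.scaleNorm p (D.coeff u)

/-- `r ∈ X^q` is the value at `a ∈ X^p` of the extension by continuity of the operator with
graph `G`. -/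
def IsExtValue (D : Model H) (G : H → H → Prop) (p q : ℝ) (a r : ℕ → ℝ) : Prop :=
  D.MemX p a ∧ D.MemX q r ∧ ∃ u w : ℕ → H, (∀ j, G (u j) (w j)) ∧
    Tendsto (fun j => D.scaleNorm p (a - D.coeff (u j))) atTop (𝓝 0) ∧
    Tendsto (fun j => D.scaleNorm q (r - D.coeff (w j))) atTop (𝓝 0)

/-- The standing assumptions, expressing `C₁ ≃ C₀^β` and `A⁻¹ ≃ C₀^ℓ`. -/
structure Assumptions (D : Model H) (s₀ β ℓ : ℝ) : Prop where
  s₀_nonneg : 0 ≤ s₀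
  s₀_lt_one : s₀ < 1
  β_nonneg : 0 ≤ β
  ℓ_nonneg : 0 ≤ ℓ
  /-- `C₀^s` is trace class for all `s > s₀` -/
  trace : ∀ s, s₀ < s → Summable fun k => D.σ k ^ s
  /-- `Δ > 2 s₀`, where `Δ = 2ℓ - β + 1` -/
  delta : 2 * s₀ < 2 * ℓ - β + 1
  /-- `‖C₁^{-1/2} A⁻¹ u‖ ≍ ‖C₀^{ℓ-β/2} u‖` on `X^{β-2ℓ}` -/
  equiv : ∃ c c' : ℝ≥0, 0 < c ∧ 0 < c' ∧ ∀ u, D.MemX (β - 2 * ℓ) (D.coeff u) →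
    ∃ w, D.graphInvSqrtAinv u w ∧ c * D.scaleNorm (β - 2 * ℓ) (D.coeff u) ≤ ‖w‖ₑ ∧
      ‖w‖ₑ ≤ c' * D.scaleNorm (β - 2 * ℓ) (D.coeff u)
  /-- `‖C₀^{-ρ/2} C₁^{1/2} u‖ ≤ c₁ ‖C₀^{(β-ρ)/2} u‖` on `X^{ρ-β}` -/
  sqrt_bound : ∃ c₁ : ℝ≥0, 0 < c₁ ∧ ∀ ρ : ℝ, (⌈β - s₀ - 1⌉ : ℝ) ≤ ρ → ρ < β - s₀ →
    D.MapsBoundedly (fun u w => D.R u = w) (ρ - β) ρ c₁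
  /-- `‖C₀^{s/2} C₁^{-1/2} u‖ ≤ c₂ ‖C₀^{(s-β)/2} u‖` on `X^{β-s}` -/
  invSqrt_bound : ∃ c₂ : ℝ≥0, 0 < c₂ ∧ ∀ s, s₀ < s → s ≤ 1 →
    D.ExtendsBoundedly D.graphInvSqrt (β - s) (-s) c₂
  /-- `‖C₀^{-s/2} C₁^{-1/2} A⁻¹ u‖ ≤ c₃ ‖C₀^{(2ℓ-β-s)/2} u‖` on `X^{s+β-2ℓ}` -/
  invSqrtAinv_bound : ∃ c₃ : ℝ≥0, 0 < c₃ ∧ ∀ s, s₀ < s → s ≤ 1 →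
    D.MapsBoundedly D.graphInvSqrtAinv (s + β - 2 * ℓ) s c₃
  /-- `‖C₀^{η/2} A⁻¹ C₁⁻¹ u‖ ≤ c₄ ‖C₀^{η/2+ℓ-β} u‖` on `X^{2β-2ℓ-η}` -/
  ainvInv_bound : ∃ c₄ : ℝ≥0, 0 < c₄ ∧ ∀ η, β - 2 * ℓ ≤ η → η ≤ 1 →
    D.ExtendsBoundedly D.graphAinvInv (2 * β - 2 * ℓ - η) (-η) c₄

/-! ### Noise, data and posterior mean -/

/-- `ξ ∼ N(0, C₁)` as a (generalized) random element with coordinates `ξ_k = ⟨ξ, φ_k⟩`: every finite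
combination `⟨ξ, h⟩`, `h = ∑ c_k φ_k`, is a centred Gaussian of variance `⟨C₁ h, h⟩`. -/
structure IsNoise (D : Model H) {Ω : Type*} [MeasurableSpace Ω] (P : Measure Ω)
    (ξ : Ω → ℕ → ℝ) : Prop where
  measurable : Measurable ξ
  gaussian : ∀ c : ℕ →₀ ℝ, P.map (fun ω => c.sum fun k x => x * ξ ω k) =
    gaussianReal 0
      (⟪D.C₁ (c.sum fun k x => x • D.φ k), c.sum fun k x => x • D.φ k⟫_ℝ).toNNReal

/-- The data `y† = A⁻¹ u† + n^{-1/2} ξ`. -/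
def data (D : Model H) (u : H) (n : ℝ) (ξ : ℕ → ℝ) : ℕ → ℝ :=
  D.coeff (D.Ainv u) + (√n)⁻¹ • ξ

/-- `C₁^{-1/2} A⁻¹ u`, for `u` with `A⁻¹ u` in the range of the injective operator `C₁^{1/2}`. -/
def invSqrtAinv (D : Model H) (u : H) : H := Function.invFun D.R (D.Ainv u)

/-- `B(u,v) = ⟨C₁^{-1/2} A⁻¹ u, C₁^{-1/2} A⁻¹ v⟩ + lam ⟨C₀^{-1/2} u, C₀^{-1/2} v⟩` on `X^1`. -/
def bilin (D : Model H) (lam : ℝ) (u v : H) : ℝ :=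
  ⟪D.invSqrtAinv u, D.invSqrtAinv v⟫_ℝ +
    lam * pairing (D.pow (-1 / 2) (D.coeff u)) (D.pow (-1 / 2) (D.coeff v))

/-- `m ∈ X^1` is a weak solution of `B_lam m = A⁻¹ C₁⁻¹ y`, where `B_lam = A⁻¹ C₁⁻¹ A⁻¹ + lam C₀⁻¹`
and `A⁻¹ C₁⁻¹` is the extension `X^{2β-2ℓ-1} → X^{-1}`. -/
def IsPosteriorMean (D : Model H) (β ℓ lam : ℝ) (y : ℕ → ℝ) (m : H) : Prop :=
  D.MemX 1 (D.coeff m) ∧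
  ∃ r, D.IsExtValue D.graphAinvInv (2 * β - 2 * ℓ - 1) (-1) y r ∧
    ∀ v, D.MemX 1 (D.coeff v) → D.bilin lam m v = pairing r (D.coeff v)

end Model

/-- `η(θ) = (1-θ)(β-2ℓ) + θ`. -/
def eta (β ℓ θ : ℝ) : ℝ := (1 - θ) * (β - 2 * ℓ) + θ

/-- The scaling `τ(n)` of the prior. -/
def tau (θ₁ θ₂ n : ℝ) : ℝ := n ^ ((θ₂ - θ₁ - 1) / (2 * (θ₁ - θ₂ + 2)))

end BayesInv

end

/-!
The isometries `C₀^{t/2} : H → X^t` turn bounded operators of the scale into bounded operators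
of `H`. The extension of `A⁻¹ C₁⁻¹` represents the form
`⟨C₁^{-1/2} A⁻¹ u, C₁^{-1/2} A⁻¹ v⟩` when evaluated at `A⁻¹ u`, so the weak equation is a
Lax–Milgram problem whose solution depends continuously on the data, and the error `e = m - u`
satisfies
`B(e, v) = n^{-1/2} ⟨A⁻¹ C₁⁻¹ ξ, v⟩ - lam ⟨C₀⁻¹ u, v⟩`.
Testing with `v = e`, coercivity controls `‖e‖²_{β-2ℓ} + lam ‖e‖²_1`, interpolation between these
two norms gives every `‖e‖_{η(θ)}`, and Young's inequality absorbs the error on the right-hand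
side. The choice of `lam` makes the contributions of the noise and of the prior equal.
-/

namespace BayesInv

section BoundedOperators

variable {𝕜 E F G : Type*} [NontriviallyNormedField 𝕜] [NormedAddCommGroup E] [NormedSpace 𝕜 E]
  [NormedAddCommGroup F] [NormedSpace 𝕜 F] [NormedAddCommGroup G] [NormedSpace 𝕜 G]

lemma exists_closure_eq_graph_of_dense_domain [CompleteSpace F] (Z : Submodule 𝕜 (E × F)) {C : ℝ}
    (hdense : Dense (Prod.fst '' (Z : Set (E × F)))) (hbound : ∀ x ∈ Z, ‖x.2‖ ≤ C * ‖x.1‖) :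
    ∃ T : E →L[𝕜] F, (∀ x, ‖T x‖ ≤ C * ‖x‖) ∧ closure (Z : Set (E × F)) = {x | T x.1 = x.2} := by
  let dom : Z →ₗ[𝕜] E := LinearMap.fst 𝕜 E F ∘ₗ Z.subtype
  let val : Z →ₗ[𝕜] F := LinearMap.snd 𝕜 E F ∘ₗ Z.subtype
  have hdom : DenseRange dom := by
    rwa [DenseRange, LinearMap.coe_comp, Set.range_comp, Submodule.coe_subtype, Subtype.range_coe]
  have hval : ∀ z, ‖val z‖ ≤ C * ‖dom z‖ := fun z => hbound z z.2
  let T := val.extendOfNorm dom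
  have hT : ∀ x ∈ Z, T x.1 = x.2 := fun x hx =>
    LinearMap.extendOfNorm_eq hdom ⟨C, hval⟩ ⟨x, hx⟩
  refine ⟨T, LinearMap.norm_extendOfNorm_apply_le hdom C hval, subset_antisymm ?_ ?_⟩
  · exact closure_minimal hT (isClosed_eq (T.continuous.comp continuous_fst) continuous_snd)
  · rintro ⟨x, y⟩ hxy
    obtain rfl : T x = y := hxy
    refine map_mem_closure (f := fun x => (x, T x)) (by fun_prop) (hdense x) ?_
    rintro _ ⟨z, hz, rfl⟩
    change (z.1, T z.1) ∈ Z
    rwa [hT z hz]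

lemma exists_clm_comp_eq_of_range_le [CompleteSpace E] [CompleteSpace F] (B : E →L[𝕜] G)
    {R : F →L[𝕜] G} (hR : Function.Injective R) (h : B.range ≤ R.range) :
    ∃ K : E →L[𝕜] F, R ∘L K = B := by
  let K : E →ₗ[𝕜] F := (LinearEquiv.ofInjective (R : F →ₗ[𝕜] G) hR).symm ∘ₗ
    (B : E →ₗ[𝕜] G).codRestrict R.range fun x => h ⟨x, rfl⟩
  have hK (x : E) : R (K x) = B x :=
    congrArg Subtype.val ((LinearEquiv.ofInjective (R : F →ₗ[𝕜] G) hR).apply_symm_apply _)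
  refine ⟨.ofSeqClosedGraph (g := K) fun x a b hx hKx => hR ?_, ContinuousLinearMap.ext hK⟩
  refine tendsto_nhds_unique ((R.continuous.tendsto b).comp hKx) ?_
  simpa only [Function.comp_def, hK] using (B.continuous.tendsto a).comp hx

end BoundedOperators

variable {H : Type*} [NormedAddCommGroup H] [InnerProductSpace ℝ H] [CompleteSpace H]

lemma exists_clm_forall_inner_add_mul_inner_eq_iff {F : Type*} [NormedAddCommGroup F]
    [InnerProductSpace ℝ F] [CompleteSpace F] (K : H →L[ℝ] F) {lam : ℝ} (hlam : 0 < lam) :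
    ∃ L : H →L[ℝ] H, ∀ g x,
      (∀ y, ⟪K x, K y⟫_ℝ + lam * ⟪x, y⟫_ℝ = ⟪g, y⟫_ℝ) ↔ x = L g := by
  let B : H →L[ℝ] H →L[ℝ] ℝ :=
    innerSL ℝ ∘L (ContinuousLinearMap.adjoint K ∘L K + lam • ContinuousLinearMap.id ℝ H)
  have hB (x y : H) : B x y = ⟪K x, K y⟫_ℝ + lam * ⟪x, y⟫_ℝ := by
    change ⟪ContinuousLinearMap.adjoint K (K x) + lam • x, y⟫_ℝ = _
    rw [inner_add_left, real_inner_smul_left, ContinuousLinearMap.adjoint_inner_left]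
  have hcoercive : IsCoercive B := by
    refine ⟨lam, hlam, fun x => ?_⟩
    rw [hB, real_inner_self_eq_norm_mul_norm, real_inner_self_eq_norm_mul_norm, ← mul_assoc]
    exact le_add_of_nonneg_left (mul_self_nonneg _)
  let Λ := hcoercive.continuousLinearEquivOfBilin
  refine ⟨Λ.symm, fun g x => ?_⟩
  rw [ContinuousLinearEquiv.coe_coe, ContinuousLinearEquiv.eq_symm_apply]
  constructor
  · exact fun h => (hcoercive.unique_continuousLinearEquivOfBilin fun y => by rw [hB, h]).symm
  · rintro rfl y
    rw [hcoercive.continuousLinearEquivOfBilin_apply, hB]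

lemma ennreal_add_sq_le (x y : ℝ≥0∞) : (x + y) ^ 2 ≤ 2 * (x ^ 2 + y ^ 2) := by
  have h := ENNReal.rpow_add_le_mul_rpow_add_rpow x y one_le_two
  norm_num at h
  exact_mod_cast h

lemma le_of_le_mul_add_mul_of_sq_le {N a b α₁ α₂ μ₁ μ₂ : ℝ≥0∞} (hN : N ≠ ∞)
    (h : N ≤ a * α₁ + b * α₂) (h₁ : α₁ ^ 2 ≤ μ₁ * N) (h₂ : α₂ ^ 2 ≤ μ₂ * N) :
    N ≤ 2 * (a ^ 2 * μ₁ + b ^ 2 * μ₂) := by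
  obtain rfl | hN₀ := eq_or_ne N 0
  · exact zero_le
  refine (ENNReal.mul_le_mul_iff_left hN₀ hN).1 ?_
  calc N * N = N ^ 2 := (sq N).symm
    _ ≤ (a * α₁ + b * α₂) ^ 2 := by gcongr
    _ ≤ 2 * ((a * α₁) ^ 2 + (b * α₂) ^ 2) := ennreal_add_sq_le _ _
    _ = 2 * (a ^ 2 * α₁ ^ 2 + b ^ 2 * α₂ ^ 2) := by ring
    _ ≤ 2 * (a ^ 2 * (μ₁ * N) + b ^ 2 * (μ₂ * N)) := by gcongr
    _ = 2 * (a ^ 2 * μ₁ + b ^ 2 * μ₂) * N := by ring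

lemma one_div_mul_tau_sq {θ₁ θ₂ n : ℝ} (hd : θ₁ - θ₂ + 2 ≠ 0) (hn : 0 < n) :
    1 / (n * tau θ₁ θ₂ n ^ 2) = n ^ (-1 / (θ₁ - θ₂ + 2)) := by
  nth_rw 1 [tau, ← Real.rpow_mul_natCast hn.le, ← Real.rpow_one n, ← Real.rpow_add hn, one_div,
    ← Real.rpow_neg hn.le]
  congr 1
  push_cast
  field_simp
  ring

/-- The choice of `lam` balances the contributions of the noise and of the regularization. -/
lemma inv_mul_rpow_neg_eq {θ₁ θ₂ n lam : ℝ} (hd : θ₁ - θ₂ + 2 ≠ 0) (hn : 0 < n)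
    (hlam : lam = n ^ (-1 / (θ₁ - θ₂ + 2))) : n⁻¹ * lam ^ (-θ₁) = lam ^ (2 - θ₂) := by
  rw [hlam, ← Real.rpow_neg_one, ← Real.rpow_mul hn.le, ← Real.rpow_mul hn.le, ← Real.rpow_add hn]
  congr 1
  field_simp
  ring

lemma rpow_neg_mul_rpow_eq {θ θ₁ θ₂ n lam : ℝ} (hd : θ₁ - θ₂ + 2 ≠ 0) (hn : 0 < n)
    (hlam : lam = n ^ (-1 / (θ₁ - θ₂ + 2))) :
    lam ^ (-θ) * lam ^ (2 - θ₂) = n ^ ((θ + θ₂ - 2) / (θ₁ - θ₂ + 2)) := by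
  rw [hlam, ← Real.rpow_mul hn.le, ← Real.rpow_mul hn.le, ← Real.rpow_add hn]
  congr 1
  field_simp
  ring

lemma one_div_mul_tau_sq_pos (θ₁ θ₂ : ℝ) {n : ℝ} (hn : 0 < n) : 0 < 1 / (n * tau θ₁ θ₂ n ^ 2) := by
  unfold tau
  positivity

lemma exists_pos_le_ofReal {x : ℝ≥0∞} (hx : x ≠ ∞) : ∃ c : ℝ, 0 < c ∧ x ≤ ENNReal.ofReal c :=
  ⟨x.toReal + 1, by positivity, ENNReal.le_ofReal_iff_toReal_le hx (by positivity) |>.2 (by simp)⟩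

lemma ofReal_inv_sqrt_sq {n : ℝ} (hn : 0 ≤ n) :
    ENNReal.ofReal (√n)⁻¹ ^ 2 = ENNReal.ofReal n⁻¹ := by
  rw [← ENNReal.ofReal_pow (by positivity), inv_pow, Real.sq_sqrt hn]

lemma ofReal_sq_mul_rpow_neg {lam θ : ℝ} (hlam : 0 < lam) :
    ENNReal.ofReal lam ^ 2 * ENNReal.ofReal (lam ^ (-θ)) = ENNReal.ofReal (lam ^ (2 - θ)) := by
  rw [← ENNReal.ofReal_pow hlam.le, ← ENNReal.ofReal_mul (by positivity), ← Real.rpow_natCast,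
    ← Real.rpow_add hlam, Nat.cast_ofNat, sub_eq_add_neg]

namespace Model

variable (D : Model H)

/-! ### The Hilbert scale -/

lemma sigma_pos (k : ℕ) : 0 < D.σ k := by
  have h := D.C₀_pos (D.φ k) (D.φ.orthonormal.ne_zero k)
  rwa [D.eigen, real_inner_smul_left, real_inner_self_eq_norm_sq, D.φ.orthonormal.1 k, one_pow,
    mul_one] at h

lemma repr_apply (h : H) (k : ℕ) : D.φ.repr h k = D.coeff h k := D.φ.repr_apply_apply h k

lemma coeff_repr_symm (a : lp (fun _ : ℕ => ℝ) 2) : D.coeff (D.φ.repr.symm a) = a := by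
  funext k
  rw [← repr_apply, LinearIsometryEquiv.apply_symm_apply]

lemma coeff_injective : Function.Injective D.coeff := fun u v h =>
  D.φ.repr.injective (lp.ext (funext fun k => by rw [D.repr_apply, D.repr_apply, h]))

lemma hasSum_coeff_mul (u v : H) : HasSum (fun k => D.coeff u k * D.coeff v k) ⟪u, v⟫_ℝ := by
  simpa only [coeff, real_inner_comm u] using D.φ.hasSum_inner_mul_inner u v

protected lemma pow_pow (s t : ℝ) (a : ℕ → ℝ) : D.pow s (D.pow t a) = D.pow (s + t) a := by
  funext k
  simp only [pow, Real.rpow_add (D.sigma_pos k), mul_assoc]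

protected lemma pow_zero (a : ℕ → ℝ) : D.pow 0 a = a := by
  funext k
  simp only [pow, Real.rpow_zero, one_mul]

lemma scaleNorm_sq (t : ℝ) (a : ℕ → ℝ) :
    D.scaleNorm t a ^ 2 = ∑' k, ENNReal.ofReal (D.σ k ^ (-t) * a k ^ 2) := by
  rw [scaleNorm, ← ENNReal.rpow_natCast, ← ENNReal.rpow_mul, Nat.cast_ofNat, one_div,
    inv_mul_cancel₀ two_ne_zero, ENNReal.rpow_one]
  refine tsum_congr fun k => ?_
  rw [← ofReal_norm, ← ENNReal.ofReal_pow (norm_nonneg _), Real.norm_eq_abs, sq_abs, pow, mul_pow,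
    ← Real.rpow_mul_natCast (D.sigma_pos k).le, Nat.cast_ofNat, div_mul_cancel₀ _ two_ne_zero]

lemma scaleNorm_pow (s t : ℝ) (a : ℕ → ℝ) :
    D.scaleNorm t (D.pow s a) = D.scaleNorm (t - 2 * s) a := by
  simp only [scaleNorm, D.pow_pow]
  ring_nf

lemma scaleNorm_zero_coeff (h : H) : D.scaleNorm 0 (D.coeff h) = ‖h‖ₑ := by
  refine (ENNReal.pow_right_strictMono two_ne_zero).injective ?_
  have hs := D.hasSum_coeff_mul h h
  simp only [← sq, real_inner_self_eq_norm_sq] at hs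
  simp only [scaleNorm_sq, neg_zero, Real.rpow_zero, one_mul]
  rw [← ENNReal.ofReal_tsum_of_nonneg (fun _ => sq_nonneg _) hs.summable, hs.tsum_eq,
    ENNReal.ofReal_pow (norm_nonneg h), ofReal_norm]

/-- The isometry `C₀^{t/2}` of `H` onto `X^t`. It transports statements about the scale to `H`. -/
noncomputable def toScale (t : ℝ) : H →ₗ[ℝ] (ℕ → ℝ) where
  toFun h := D.pow (t / 2) (D.coeff h)
  map_add' g h := by
    funext k
    simp only [pow, coeff, inner_add_right, mul_add, Pi.add_apply]
  map_smul' c h := by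
    funext k
    simp only [pow, coeff, inner_smul_right, mul_left_comm, Pi.smul_apply, smul_eq_mul,
      RingHom.id_apply]

lemma toScale_apply (t : ℝ) (h : H) : D.toScale t h = D.pow (t / 2) (D.coeff h) := rfl

lemma toScale_zero : ⇑(D.toScale 0) = D.coeff := by
  funext h
  rw [toScale_apply, zero_div, D.pow_zero]

lemma pow_neg_toScale (t : ℝ) (h : H) : D.pow (-t / 2) (D.toScale t h) = D.coeff h := by
  rw [toScale_apply, D.pow_pow, ← add_div, neg_add_cancel, zero_div, D.pow_zero]

lemma coeff_sub (u v : H) : D.coeff (u - v) = D.coeff u - D.coeff v := by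
  rw [← toScale_zero, map_sub]

lemma toScale_injective (t : ℝ) : Function.Injective (D.toScale t) := fun g h e =>
  D.coeff_injective <| by rw [← D.pow_neg_toScale t, e, pow_neg_toScale]

lemma scaleNorm_toScale (t : ℝ) (h : H) : D.scaleNorm t (D.toScale t h) = ‖h‖ₑ := by
  rw [toScale_apply, scaleNorm_pow, mul_div_cancel₀ _ two_ne_zero, sub_self, scaleNorm_zero_coeff]

variable {D}

lemma memX_iff {t : ℝ} {a : ℕ → ℝ} : D.MemX t a ↔ a ∈ LinearMap.range (D.toScale t) := by
  constructor
  · intro ha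
    have hsum : Summable fun k => D.pow (-t / 2) a k ^ 2 := by
      have h : D.scaleNorm 0 (D.pow (-t / 2) a) ^ 2 ≠ ∞ := by
        rw [scaleNorm_pow]
        ring_nf
        exact ENNReal.pow_ne_top ha.ne
      simp only [scaleNorm_sq, neg_zero, Real.rpow_zero, one_mul] at h
      simpa only [ENNReal.toReal_ofReal (sq_nonneg _)] using ENNReal.summable_toReal h
    have hmem : Memℓp (D.pow (-t / 2) a) 2 := memℓp_gen (by simpa using hsum)
    refine ⟨D.φ.repr.symm ⟨_, hmem⟩, ?_⟩
    rw [toScale_apply, coeff_repr_symm, D.pow_pow, ← add_div, add_neg_cancel, zero_div, D.pow_zero]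
  · rintro ⟨h, rfl⟩
    rw [MemX, scaleNorm_toScale]
    exact enorm_lt_top

lemma memX_toScale (t : ℝ) (h : H) : D.MemX t (D.toScale t h) := memX_iff.2 ⟨h, rfl⟩

lemma memX_zero_coeff (h : H) : D.MemX 0 (D.coeff h) := by
  rw [← toScale_zero]
  exact memX_toScale 0 h

lemma MemX.add {t : ℝ} {a b : ℕ → ℝ} (ha : D.MemX t a) (hb : D.MemX t b) : D.MemX t (a + b) :=
  memX_iff.2 (add_mem (memX_iff.1 ha) (memX_iff.1 hb))

lemma MemX.sub {t : ℝ} {a b : ℕ → ℝ} (ha : D.MemX t a) (hb : D.MemX t b) : D.MemX t (a - b) :=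
  memX_iff.2 (sub_mem (memX_iff.1 ha) (memX_iff.1 hb))

lemma MemX.smul {t : ℝ} {a : ℕ → ℝ} (ha : D.MemX t a) (c : ℝ) : D.MemX t (c • a) :=
  memX_iff.2 (Submodule.smul_mem _ c (memX_iff.1 ha))

lemma MemX.of_sub {t : ℝ} {a b : ℕ → ℝ} (ha : D.MemX t a) (hab : D.MemX t (a - b)) :
    D.MemX t b := by
  simpa only [sub_sub_cancel] using ha.sub hab

variable (D)

lemma exists_scaleNorm_le {s t : ℝ} (hst : s ≤ t) :
    ∃ C : ℝ≥0, ∀ a, D.scaleNorm s a ≤ C * D.scaleNorm t a := by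
  obtain ⟨M, hM⟩ := D.C₀_trace.tendsto_atTop_zero.bddAbove_range
  have hσ (k : ℕ) : D.σ k ^ (-s) ≤ M ^ (t - s) * D.σ k ^ (-t) := by
    rw [show -s = (t - s) + -t by ring, Real.rpow_add (D.sigma_pos k)]
    have h := Real.rpow_le_rpow (D.sigma_pos k).le (hM ⟨k, rfl⟩) (sub_nonneg.2 hst)
    exact mul_le_mul_of_nonneg_right h (Real.rpow_nonneg (D.sigma_pos k).le _)
  refine ⟨NNReal.sqrt (M ^ (t - s)).toNNReal, fun a => ?_⟩
  rw [← ENNReal.pow_le_pow_left_iff two_ne_zero, mul_pow, ← ENNReal.coe_pow, NNReal.sq_sqrt,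
    scaleNorm_sq, scaleNorm_sq, ← ENNReal.tsum_mul_left]
  refine ENNReal.tsum_le_tsum fun k => ?_
  change _ ≤ ENNReal.ofReal (M ^ (t - s)) * _
  have hM₀ : 0 ≤ M := (D.sigma_pos k).le.trans (hM ⟨k, rfl⟩)
  rw [← ENNReal.ofReal_mul (Real.rpow_nonneg hM₀ _), ← mul_assoc]
  exact ENNReal.ofReal_le_ofReal (mul_le_mul_of_nonneg_right (hσ k) (sq_nonneg _))

lemma scaleNorm_interpolation (p q : ℝ) {θ μ : ℝ} (hθ : θ ∈ Set.Icc (0 : ℝ) 1) (hμ : 0 ≤ μ)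
    (a : ℕ → ℝ) :
    ENNReal.ofReal (μ ^ θ) * D.scaleNorm ((1 - θ) * p + θ * q) a ^ 2 ≤
      D.scaleNorm p a ^ 2 + ENNReal.ofReal μ * D.scaleNorm q a ^ 2 := by
  simp only [scaleNorm_sq]
  rw [← ENNReal.tsum_mul_left, ← ENNReal.tsum_mul_left, ← ENNReal.tsum_add]
  refine ENNReal.tsum_le_tsum fun k => ?_
  have hσ := D.sigma_pos k
  have hp := Real.rpow_nonneg hσ.le (-p)
  have hq := Real.rpow_nonneg hσ.le (-q)
  have young : μ ^ θ * D.σ k ^ (-((1 - θ) * p + θ * q)) ≤ D.σ k ^ (-p) + μ * D.σ k ^ (-q) := by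
    calc μ ^ θ * D.σ k ^ (-((1 - θ) * p + θ * q))
        = (D.σ k ^ (-p)) ^ (1 - θ) * (μ * D.σ k ^ (-q)) ^ θ := by
          rw [Real.mul_rpow hμ hq, ← Real.rpow_mul hσ.le, ← Real.rpow_mul hσ.le, mul_left_comm,
            ← Real.rpow_add hσ]
          ring_nf
      _ ≤ (1 - θ) * D.σ k ^ (-p) + θ * (μ * D.σ k ^ (-q)) :=
          Real.geom_mean_le_arith_mean2_weighted (sub_nonneg.2 hθ.2) hθ.1 hp (mul_nonneg hμ hq)
            (sub_add_cancel 1 θ)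
      _ ≤ D.σ k ^ (-p) + μ * D.σ k ^ (-q) :=
          add_le_add (mul_le_of_le_one_left hp (sub_le_self 1 hθ.1))
            (mul_le_of_le_one_left (mul_nonneg hμ hq) hθ.2)
  rw [← ENNReal.ofReal_mul (Real.rpow_nonneg hμ θ), ← ENNReal.ofReal_mul hμ,
    ← ENNReal.ofReal_add (by positivity) (by positivity)]
  refine ENNReal.ofReal_le_ofReal ?_
  rw [← mul_assoc, ← mul_assoc, ← add_mul]
  exact mul_le_mul_of_nonneg_right young (sq_nonneg _)

variable {D}

lemma MemX.mono {s t : ℝ} {a : ℕ → ℝ} (ha : D.MemX t a) (hst : s ≤ t) : D.MemX s a := by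
  obtain ⟨C, hC⟩ := D.exists_scaleNorm_le hst
  exact (hC a).trans_lt (ENNReal.mul_lt_top ENNReal.coe_lt_top ha)

lemma tendsto_scaleNorm_mono {s t : ℝ} (hst : s ≤ t) {a : ℕ → ℕ → ℝ}
    (h : Tendsto (fun j => D.scaleNorm t (a j)) atTop (𝓝 0)) :
    Tendsto (fun j => D.scaleNorm s (a j)) atTop (𝓝 0) := by
  obtain ⟨C, hC⟩ := D.exists_scaleNorm_le hst
  have hlim := ENNReal.Tendsto.const_mul h (.inr (ENNReal.coe_ne_top (r := C)))
  rw [mul_zero] at hlim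
  exact tendsto_of_tendsto_of_tendsto_of_le_of_le tendsto_const_nhds hlim (fun _ => zero_le)
    fun j => hC (a j)

variable (D) in
lemma exists_clm_toScale {s t : ℝ} (hst : s ≤ t) :
    ∃ J : H →L[ℝ] H, ∀ h, D.toScale s (J h) = D.toScale t h := by
  obtain ⟨C, hC⟩ := D.exists_scaleNorm_le hst
  have hmem (h : H) : D.toScale t h ∈ LinearMap.range (D.toScale s) :=
    memX_iff.1 ((memX_toScale t h).mono hst)
  let e := LinearEquiv.ofInjective (D.toScale s) (D.toScale_injective s)
  let J : H →ₗ[ℝ] H := e.symm ∘ₗ (D.toScale t).codRestrict _ hmem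
  have hJ (h : H) : D.toScale s (J h) = D.toScale t h :=
    congrArg Subtype.val (e.apply_symm_apply _)
  refine ⟨J.mkContinuous C fun h => ?_, hJ⟩
  have hle : ‖J h‖ₑ ≤ C * ‖h‖ₑ := by
    rw [← D.scaleNorm_toScale s, ← D.scaleNorm_toScale t, hJ]
    exact hC (D.toScale t h)
  rw [enorm_eq_nnnorm, enorm_eq_nnnorm] at hle
  exact_mod_cast hle

/-! ### The duality pairing -/

lemma pairing_toScale (t : ℝ) (g h : H) :
    pairing (D.toScale (-t) g) (D.toScale t h) = ⟪g, h⟫_ℝ := by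
  rw [pairing, ← (D.hasSum_coeff_mul g h).tsum_eq]
  refine tsum_congr fun k => ?_
  have e : D.σ k ^ (-t / 2) * D.σ k ^ (t / 2) = 1 := by
    rw [← Real.rpow_add (D.sigma_pos k), ← add_div, neg_add_cancel, zero_div, Real.rpow_zero]
  rw [toScale_apply, toScale_apply, pow, pow, mul_mul_mul_comm, e, one_mul]

lemma pairing_coeff (g h : H) : pairing (D.coeff g) (D.coeff h) = ⟪g, h⟫_ℝ :=
  (D.hasSum_coeff_mul g h).tsum_eq

lemma pairing_pow (s : ℝ) (a b : ℕ → ℝ) :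
    pairing (D.pow s a) (D.pow s b) = pairing (D.pow (2 * s) a) b := by
  refine tsum_congr fun k => ?_
  rw [pow, pow, pow, two_mul, Real.rpow_add (D.sigma_pos k)]
  ring

lemma enorm_pairing_le {t : ℝ} {a b : ℕ → ℝ} (ha : D.MemX (-t) a) (hb : D.MemX t b) :
    ‖pairing a b‖ₑ ≤ D.scaleNorm (-t) a * D.scaleNorm t b := by
  obtain ⟨g, rfl⟩ := memX_iff.1 ha
  obtain ⟨h, rfl⟩ := memX_iff.1 hb
  rw [pairing_toScale, scaleNorm_toScale, scaleNorm_toScale]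
  simp only [enorm_eq_nnnorm]
  exact_mod_cast nnnorm_inner_le_nnnorm (𝕜 := ℝ) g h

lemma pairing_add_smul_left {t : ℝ} {a a' b : ℕ → ℝ} (ha : D.MemX (-t) a) (ha' : D.MemX (-t) a')
    (hb : D.MemX t b) (c : ℝ) : pairing (a + c • a') b = pairing a b + c * pairing a' b := by
  obtain ⟨g, rfl⟩ := memX_iff.1 ha
  obtain ⟨g', rfl⟩ := memX_iff.1 ha'
  obtain ⟨h, rfl⟩ := memX_iff.1 hb
  rw [← map_smul, ← map_add, pairing_toScale, pairing_toScale, pairing_toScale, inner_add_left,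
    real_inner_smul_left]

lemma tendsto_pairing {t : ℝ} {r b : ℕ → ℝ} {a : ℕ → ℕ → ℝ} (hr : D.MemX (-t) r)
    (hb : D.MemX t b) (h : Tendsto (fun j => D.scaleNorm (-t) (r - a j)) atTop (𝓝 0)) :
    Tendsto (fun j => pairing (a j) b) atTop (𝓝 (pairing r b)) := by
  have hlim := ENNReal.Tendsto.mul_const h (.inr hb.ne)
  rw [zero_mul] at hlim
  rw [tendsto_iff_edist_tendsto_0]
  refine tendsto_of_tendsto_of_tendsto_of_le_of_le' tendsto_const_nhds hlim
    (.of_forall fun _ => zero_le) ?_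
  filter_upwards [h.eventually_lt_const ENNReal.zero_lt_top] with j hj
  have hadd := pairing_add_smul_left hr (hr.of_sub hj) hb (-1)
  rw [neg_one_smul, ← sub_eq_add_neg, neg_one_mul, ← sub_eq_add_neg] at hadd
  rw [edist_comm, edist_eq_enorm_sub, ← hadd]
  exact enorm_pairing_le hj hb

/-! ### Extension by continuity -/

lemma scaleNorm_toScale_sub (t : ℝ) (g h : H) :
    D.scaleNorm t (D.toScale t g - D.toScale t h) = edist g h := by
  rw [← map_sub, scaleNorm_toScale, edist_eq_enorm_sub]

lemma IsExtValue.mono {G : H → H → Prop} {p p' q q' : ℝ} {a r : ℕ → ℝ}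
    (h : D.IsExtValue G p q a r) (hp : p' ≤ p) (hq : q' ≤ q) : D.IsExtValue G p' q' a r := by
  obtain ⟨ha, hr, u, w, hG, hu, hw⟩ := h
  exact ⟨ha.mono hp, hr.mono hq, u, w, hG, tendsto_scaleNorm_mono hp hu,
    tendsto_scaleNorm_mono hq hw⟩

variable (D) in
/-- The part in `X^p × X^q` of the operator with graph `Γ`, transported to `H × H` by the isometries
`C₀^{p/2}` and `C₀^{q/2}`. -/
noncomputable def scaleGraph (Γ : Submodule ℝ (H × H)) (p q : ℝ) : Submodule ℝ (H × H) :=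
  (Γ.map ((D.toScale 0).prodMap (D.toScale 0))).comap ((D.toScale p).prodMap (D.toScale q))

section Extension

variable {G : H → H → Prop} {Γ : Submodule ℝ (H × H)} {p q : ℝ} {c : ℝ≥0}

lemma mem_scaleGraph_iff (hΓ : ∀ u w, G u w ↔ (u, w) ∈ Γ) {x : H × H} :
    x ∈ D.scaleGraph Γ p q ↔
      ∃ u w, G u w ∧ D.coeff u = D.toScale p x.1 ∧ D.coeff w = D.toScale q x.2 := by
  simp only [scaleGraph, Submodule.mem_comap, Submodule.mem_map, Prod.exists,
    LinearMap.prodMap_apply, Prod.mk.injEq, toScale_zero, hΓ]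

lemma isExtValue_toScale_iff (hΓ : ∀ u w, G u w ↔ (u, w) ∈ Γ) {g k : H} :
    D.IsExtValue G p q (D.toScale p g) (D.toScale q k) ↔
      (g, k) ∈ closure (D.scaleGraph Γ p q : Set (H × H)) := by
  constructor
  · rintro ⟨-, -, u, w, hG, hu, hw⟩
    rw [EMetric.mem_closure_iff]
    intro ε hε
    obtain ⟨j, hju, hjw⟩ := ((hu.eventually_lt_const hε).and (hw.eventually_lt_const hε)).exists
    obtain ⟨g', hg'⟩ := memX_iff.1 ((memX_toScale p g).of_sub (hju.trans_le le_top))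
    obtain ⟨k', hk'⟩ := memX_iff.1 ((memX_toScale q k).of_sub (hjw.trans_le le_top))
    refine ⟨(g', k'), (mem_scaleGraph_iff hΓ).2 ⟨u j, w j, hG j, hg'.symm, hk'.symm⟩, ?_⟩
    rw [← hg', scaleNorm_toScale_sub] at hju
    rw [← hk', scaleNorm_toScale_sub] at hjw
    exact max_lt hju hjw
  · intro h
    obtain ⟨x, hx, hlim⟩ := mem_closure_iff_seq_limit.1 h
    choose u w hG hu hw using fun j => (mem_scaleGraph_iff hΓ).1 (hx j)
    have hfst := tendsto_iff_edist_tendsto_0.1 hlim.fst_nhds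
    have hsnd := tendsto_iff_edist_tendsto_0.1 hlim.snd_nhds
    refine ⟨memX_toScale p g, memX_toScale q k, u, w, hG, ?_, ?_⟩
    · simpa only [hu, scaleNorm_toScale_sub, edist_comm g] using hfst
    · simpa only [hw, scaleNorm_toScale_sub, edist_comm k] using hsnd

lemma ExtendsBoundedly.memX (hG : D.ExtendsBoundedly G p q c) {u w : H} (h : G u w)
    (hu : D.MemX p (D.coeff u)) : D.MemX q (D.coeff w) :=
  (hG.2 u w h hu).trans_lt (ENNReal.mul_lt_top ENNReal.coe_lt_top hu)

lemma ExtendsBoundedly.dense_fst_scaleGraph (hG : D.ExtendsBoundedly G p q c)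
    (hΓ : ∀ u w, G u w ↔ (u, w) ∈ Γ) :
    Dense (Prod.fst '' (D.scaleGraph Γ p q : Set (H × H))) := by
  intro g
  rw [EMetric.mem_closure_iff]
  intro ε hε
  obtain ⟨u, w, huw, hlt⟩ := hG.1 (D.toScale p g) (memX_toScale p g) ε hε
  have hu := (memX_toScale p g).of_sub (hlt.trans_le le_top)
  obtain ⟨g', hg'⟩ := memX_iff.1 hu
  obtain ⟨k, hk⟩ := memX_iff.1 (hG.memX huw hu)
  refine ⟨g', ⟨(g', k), (mem_scaleGraph_iff hΓ).2 ⟨u, w, huw, hg'.symm, hk.symm⟩, rfl⟩, ?_⟩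
  rwa [← hg', scaleNorm_toScale_sub] at hlt

lemma ExtendsBoundedly.norm_snd_le (hG : D.ExtendsBoundedly G p q c)
    (hΓ : ∀ u w, G u w ↔ (u, w) ∈ Γ) {x : H × H} (hx : x ∈ D.scaleGraph Γ p q) :
    ‖x.2‖ ≤ c * ‖x.1‖ := by
  obtain ⟨u, w, huw, hu, hw⟩ := (mem_scaleGraph_iff hΓ).1 hx
  have h := hG.2 u w huw (hu ▸ memX_toScale p x.1)
  rw [hu, hw, scaleNorm_toScale, scaleNorm_toScale, enorm_eq_nnnorm, enorm_eq_nnnorm] at h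
  exact_mod_cast h

lemma ExtendsBoundedly.exists_clm (hG : D.ExtendsBoundedly G p q c)
    (hΓ : ∀ u w, G u w ↔ (u, w) ∈ Γ) :
    ∃ T : H →L[ℝ] H, (∀ g, ‖T g‖ ≤ c * ‖g‖) ∧
      ∀ g r, D.IsExtValue G p q (D.toScale p g) r ↔ r = D.toScale q (T g) := by
  obtain ⟨T, hTc, hT⟩ := exists_closure_eq_graph_of_dense_domain _ (hG.dense_fst_scaleGraph hΓ)
    fun x hx => hG.norm_snd_le hΓ hx
  have hiff (g k : H) : D.IsExtValue G p q (D.toScale p g) (D.toScale q k) ↔ T g = k := by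
    rw [isExtValue_toScale_iff hΓ, hT]
    rfl
  refine ⟨T, hTc, fun g r => ⟨fun h => ?_, ?_⟩⟩
  · obtain ⟨k, rfl⟩ := memX_iff.1 h.2.1
    rw [(hiff g k).1 h]
  · rintro rfl
    exact (hiff g _).2 rfl

lemma ExtendsBoundedly.exists_isExtValue (hG : D.ExtendsBoundedly G p q c)
    (hΓ : ∀ u w, G u w ↔ (u, w) ∈ Γ) {a : ℕ → ℝ} (ha : D.MemX p a) :
    ∃ r, D.IsExtValue G p q a r ∧ D.scaleNorm q r ≤ c * D.scaleNorm p a := by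
  obtain ⟨T, hTc, hT⟩ := hG.exists_clm hΓ
  obtain ⟨g, rfl⟩ := memX_iff.1 ha
  refine ⟨_, (hT g _).2 rfl, ?_⟩
  rw [scaleNorm_toScale, scaleNorm_toScale, enorm_eq_nnnorm, enorm_eq_nnnorm]
  exact_mod_cast hTc g

lemma ExtendsBoundedly.eq_add_smul_of_isExtValue (hG : D.ExtendsBoundedly G p q c)
    (hΓ : ∀ u w, G u w ↔ (u, w) ∈ Γ) {a a' r r' r'' : ℕ → ℝ} {x : ℝ} (h : D.IsExtValue G p q a r)
    (h' : D.IsExtValue G p q a' r') (h'' : D.IsExtValue G p q (a + x • a') r'') :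
    r'' = r + x • r' := by
  obtain ⟨T, -, hT⟩ := hG.exists_clm hΓ
  obtain ⟨g, rfl⟩ := memX_iff.1 h.1
  obtain ⟨g', rfl⟩ := memX_iff.1 h'.1
  rw [← map_smul, ← map_add] at h''
  rw [(hT _ _).1 h, (hT _ _).1 h', (hT _ _).1 h'', map_add, map_smul, map_add, map_smul]

end Extension

/-! ### The operators of the inverse problem -/

variable (D)

lemma inner_R (x y : H) : ⟪D.R x, y⟫_ℝ = ⟪x, D.R y⟫_ℝ := D.R_pos.isSymmetric x y

lemma R_R (x : H) : D.R (D.R x) = D.C₁ x := by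
  rw [← D.R_sq, ContinuousLinearMap.comp_apply]

lemma R_injective : Function.Injective D.R := by
  refine (injective_iff_map_eq_zero _).2 fun x hx => of_not_not fun h => ?_
  have hpos := D.C₁_pos x h
  rw [← R_R, hx, map_zero, inner_zero_left] at hpos
  exact hpos.false

lemma inner_Ainv (x y : H) : ⟪D.Ainv x, y⟫_ℝ = ⟪x, D.Ainv y⟫_ℝ := by
  obtain ⟨hx, hAx⟩ := D.A_Ainv x
  obtain ⟨hy, hAy⟩ := D.A_Ainv y
  have hsymm := LinearPMap.adjoint_isFormalAdjoint D.A_selfAdjoint.dense_domain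
  rw [LinearPMap.isSelfAdjoint_def.1 D.A_selfAdjoint] at hsymm
  have h := hsymm ⟨_, hx⟩ ⟨_, hy⟩
  rw [hAx, hAy] at h
  exact h.symm

variable {D}

lemma invSqrtAinv_eq {u w : H} (h : D.graphInvSqrtAinv u w) : D.invSqrtAinv u = w := by
  rw [invSqrtAinv, ← h, Function.leftInverse_invFun D.R_injective]

lemma graphAinvInv_iff (u w : H) : D.graphAinvInv u w ↔ (u, w) ∈ (D.C₁.prod D.Ainv).range := by
  simp [graphAinvInv]

variable (D) in
/-- The bounded operator `C₀^{1/2}` on `H`, whose range is `X^1`. -/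
noncomputable def sqrtC₀ : H →L[ℝ] H := (D.exists_clm_toScale zero_le_one).choose

lemma coeff_sqrtC₀ (x : H) : D.coeff (D.sqrtC₀ x) = D.toScale 1 x := by
  rw [← toScale_zero]
  exact (D.exists_clm_toScale zero_le_one).choose_spec x

lemma memX_one_iff {u : H} : D.MemX 1 (D.coeff u) ↔ ∃ x, D.sqrtC₀ x = u := by
  simp only [memX_iff, LinearMap.mem_range, ← coeff_sqrtC₀, D.coeff_injective.eq_iff]

lemma bilin_sqrtC₀ (lam : ℝ) (x y : H) : D.bilin lam (D.sqrtC₀ x) (D.sqrtC₀ y) =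
    ⟪D.invSqrtAinv (D.sqrtC₀ x), D.invSqrtAinv (D.sqrtC₀ y)⟫_ℝ + lam * ⟪x, y⟫_ℝ := by
  rw [bilin, coeff_sqrtC₀, coeff_sqrtC₀, pow_neg_toScale, pow_neg_toScale, pairing_coeff]

lemma enorm_bilin_self {lam : ℝ} (hlam : 0 ≤ lam) {e : H} (he : D.MemX 1 (D.coeff e)) :
    ‖D.bilin lam e e‖ₑ =
      ‖D.invSqrtAinv e‖ₑ ^ 2 + ENNReal.ofReal lam * D.scaleNorm 1 (D.coeff e) ^ 2 := by
  obtain ⟨x, rfl⟩ := memX_one_iff.1 he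
  rw [bilin_sqrtC₀, real_inner_self_eq_norm_sq, real_inner_self_eq_norm_sq, coeff_sqrtC₀,
    scaleNorm_toScale, Real.enorm_of_nonneg (by positivity),
    ENNReal.ofReal_add (by positivity) (by positivity), ENNReal.ofReal_mul hlam,
    ENNReal.ofReal_pow (norm_nonneg _), ENNReal.ofReal_pow (norm_nonneg _), ofReal_norm,
    ofReal_norm]

variable (D) in
/-- The energy `‖a‖_p² + lam ‖a‖_1²`. For `p = β - 2ℓ` it is equivalent to the quadratic form
`B(a, a)`, uniformly in `lam`. -/
noncomputable def energy (p lam : ℝ) (a : ℕ → ℝ) : ℝ≥0∞ :=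
  D.scaleNorm p a ^ 2 + ENNReal.ofReal lam * D.scaleNorm 1 a ^ 2

lemma energy_ne_top {p lam : ℝ} (hp : p ≤ 1) {a : ℕ → ℝ} (ha : D.MemX 1 a) :
    D.energy p lam a ≠ ∞ :=
  ENNReal.add_ne_top.2 ⟨ENNReal.pow_ne_top (ha.mono hp).ne,
    ENNReal.mul_ne_top ENNReal.ofReal_ne_top (ENNReal.pow_ne_top ha.ne)⟩

lemma scaleNorm_eta_sq_le (β ℓ : ℝ) {θ lam : ℝ} (hθ : θ ∈ Set.Icc (0 : ℝ) 1) (hlam : 0 < lam)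
    (a : ℕ → ℝ) : D.scaleNorm (eta β ℓ θ) a ^ 2 ≤
      ENNReal.ofReal (lam ^ (-θ)) * D.energy (β - 2 * ℓ) lam a := by
  have h := D.scaleNorm_interpolation (β - 2 * ℓ) 1 hθ hlam.le a
  rw [mul_one] at h
  have h' := mul_le_mul_right h (ENNReal.ofReal (lam ^ (-θ)))
  rwa [← mul_assoc, ← ENNReal.ofReal_mul (Real.rpow_nonneg hlam.le _), ← Real.rpow_add hlam,
    neg_add_cancel, Real.rpow_zero, ENNReal.ofReal_one, one_mul] at h'

namespace Assumptions

variable {s₀ β ℓ : ℝ}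

lemma β_sub_lt_one (hD : D.Assumptions s₀ β ℓ) : β - 2 * ℓ < 1 := by
  linarith [hD.delta, hD.s₀_nonneg]

lemma R_invSqrtAinv (hD : D.Assumptions s₀ β ℓ) {u : H} (hu : D.MemX (β - 2 * ℓ) (D.coeff u)) :
    D.R (D.invSqrtAinv u) = D.Ainv u := by
  obtain ⟨_, _, -, -, h⟩ := hD.equiv
  obtain ⟨w, hw, -⟩ := h u hu
  rwa [invSqrtAinv_eq hw]

lemma memX_Ainv (hD : D.Assumptions s₀ β ℓ) {u : H} (hu : D.MemX (β - 2 * ℓ) (D.coeff u)) {ρ : ℝ}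
    (hρ : ρ < β - s₀) : D.MemX ρ (D.coeff (D.Ainv u)) := by
  obtain ⟨c, -, h⟩ := hD.sqrt_bound
  have hceil : (⌈β - s₀ - 1⌉ : ℝ) < β - s₀ := by linarith [Int.ceil_lt_add_one (β - s₀ - 1)]
  have hmax : max (⌈β - s₀ - 1⌉ : ℝ) ρ < β - s₀ := max_lt hceil hρ
  have hw : D.MemX (max (⌈β - s₀ - 1⌉ : ℝ) ρ - β) (D.coeff (D.invSqrtAinv u)) :=
    (memX_zero_coeff _).mono (by linarith [hD.s₀_nonneg])
  obtain ⟨_, rfl, hle⟩ := h _ (le_max_left _ _) hmax _ hw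
  rw [hD.R_invSqrtAinv hu] at hle
  exact MemX.mono (hle.trans_lt (ENNReal.mul_lt_top ENNReal.coe_lt_top hw)) (le_max_right _ _)

lemma memX_invSqrtAinv (hD : D.Assumptions s₀ β ℓ) {s : ℝ} (hs₀ : s₀ < s) (hs₁ : s ≤ 1) {v : H}
    (hv : D.MemX (s + β - 2 * ℓ) (D.coeff v)) : D.MemX s (D.coeff (D.invSqrtAinv v)) := by
  obtain ⟨c, -, h⟩ := hD.invSqrtAinv_bound
  obtain ⟨w, hw, hle⟩ := h s hs₀ hs₁ v hv
  rw [invSqrtAinv_eq hw]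
  exact hle.trans_lt (ENNReal.mul_lt_top ENNReal.coe_lt_top hv)

lemma tendsto_R_of_tendsto_C₁ (hD : D.Assumptions s₀ β ℓ) {s : ℝ} (hs₀ : s₀ < s) (hs₁ : s ≤ 1)
    {u : H} (hu : D.MemX (β - 2 * ℓ) (D.coeff u)) {z : ℕ → H}
    (h : Tendsto (fun j => D.scaleNorm (β - s) (D.coeff (D.Ainv u) - D.coeff (D.C₁ (z j)))) atTop
      (𝓝 0)) :
    Tendsto (fun j => D.scaleNorm (-s) (D.coeff (D.invSqrtAinv u) - D.coeff (D.R (z j)))) atTop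
      (𝓝 0) := by
  obtain ⟨c, -, hc⟩ := hD.invSqrt_bound
  have hlim := ENNReal.Tendsto.const_mul h (.inr (ENNReal.coe_ne_top (r := c)))
  rw [mul_zero] at hlim
  refine tendsto_of_tendsto_of_tendsto_of_le_of_le' tendsto_const_nhds hlim
    (.of_forall fun _ => zero_le) ?_
  filter_upwards [h.eventually_lt_const ENNReal.zero_lt_top] with j hj
  rw [← coeff_sub] at hj ⊢
  rw [← coeff_sub]
  refine (hc s hs₀ hs₁).2 _ _ ?_ hj
  rw [graphInvSqrt, map_sub, hD.R_invSqrtAinv hu, R_R]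

/-- Along `C₁ z_j → A⁻¹ u` one has `⟨A⁻¹ z_j, v⟩ = ⟨C₁^{1/2} z_j, C₁^{-1/2} A⁻¹ v⟩`, and both sides
converge. -/
lemma pairing_eq_inner_of_isExtValue_Ainv (hD : D.Assumptions s₀ β ℓ) {s : ℝ} (hs₀ : s₀ < s)
    (hs₁ : s ≤ 1) {u v : H} (hu : D.MemX (β - 2 * ℓ) (D.coeff u))
    (hv : D.MemX (s + β - 2 * ℓ) (D.coeff v)) {r : ℕ → ℝ}
    (hr : D.IsExtValue D.graphAinvInv (β - s) (-(s + β - 2 * ℓ)) (D.coeff (D.Ainv u)) r) :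
    pairing r (D.coeff v) = ⟪D.invSqrtAinv u, D.invSqrtAinv v⟫_ℝ := by
  obtain ⟨-, hr, x, w, hG, hx, hw⟩ := hr
  choose z hzx hzw using hG
  obtain rfl : (fun j => D.C₁ (z j)) = x := funext hzx
  obtain rfl : (fun j => D.Ainv (z j)) = w := funext hzw
  have hw' : D.MemX (-s) (D.coeff (D.invSqrtAinv u)) :=
    (memX_zero_coeff _).mono (neg_nonpos.2 (hD.s₀_nonneg.trans hs₀.le))
  have hlim := tendsto_pairing hr hv hw
  have hlim' := tendsto_pairing hw' (hD.memX_invSqrtAinv hs₀ hs₁ hv)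
    (hD.tendsto_R_of_tendsto_C₁ hs₀ hs₁ hu hx)
  have hv' : D.MemX (β - 2 * ℓ) (D.coeff v) :=
    hv.mono (by linarith [hD.s₀_nonneg])
  simp only [pairing_coeff, inner_R, hD.R_invSqrtAinv hv'] at hlim'
  simp only [pairing_coeff, inner_Ainv] at hlim
  exact tendsto_nhds_unique hlim hlim'

lemma exists_isExtValue_Ainv (hD : D.Assumptions s₀ β ℓ) {u : H}
    (hu : D.MemX (β - 2 * ℓ) (D.coeff u)) :
    ∃ r, D.IsExtValue D.graphAinvInv (2 * β - 2 * ℓ - 1) (-1) (D.coeff (D.Ainv u)) r ∧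
      ∀ v, D.MemX 1 (D.coeff v) →
        pairing r (D.coeff v) = ⟪D.invSqrtAinv u, D.invSqrtAinv v⟫_ℝ := by
  obtain ⟨s, hs₀, hs₁, hsΔ⟩ : ∃ s, s₀ < s ∧ s ≤ 1 ∧ s + β - 2 * ℓ ≤ 1 :=
    ⟨min 1 (2 * ℓ - β + 1), lt_min hD.s₀_lt_one (by linarith [hD.delta, hD.s₀_nonneg]),
      min_le_left _ _, by linarith [min_le_right 1 (2 * ℓ - β + 1)]⟩
  obtain ⟨c, -, hc⟩ := hD.ainvInv_bound
  have hext := hc (s + β - 2 * ℓ) (by linarith [hD.s₀_nonneg]) hsΔ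
  rw [show 2 * β - 2 * ℓ - (s + β - 2 * ℓ) = β - s by ring] at hext
  obtain ⟨r, hr, -⟩ := hext.exists_isExtValue graphAinvInv_iff (hD.memX_Ainv hu (by linarith))
  exact ⟨r, hr.mono (by linarith) (by linarith), fun v hv =>
    hD.pairing_eq_inner_of_isExtValue_Ainv hs₀ hs₁ hu (hv.mono hsΔ) hr⟩

lemma exists_clm_invSqrtAinv_sqrtC₀ (hD : D.Assumptions s₀ β ℓ) :
    ∃ K : H →L[ℝ] H, ∀ x, D.invSqrtAinv (D.sqrtC₀ x) = K x := by
  have hrange : (D.Ainv ∘L D.sqrtC₀).range ≤ D.R.range := by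
    rintro _ ⟨x, rfl⟩
    exact ⟨_, hD.R_invSqrtAinv ((memX_one_iff.2 ⟨x, rfl⟩).mono hD.β_sub_lt_one.le)⟩
  obtain ⟨K, hK⟩ := exists_clm_comp_eq_of_range_le _ D.R_injective hrange
  exact ⟨K, fun x => invSqrtAinv_eq (DFunLike.congr_fun hK x)⟩

lemma bilin_sub_left (hD : D.Assumptions s₀ β ℓ) (lam : ℝ) {u u' v : H}
    (hu : D.MemX 1 (D.coeff u)) (hu' : D.MemX 1 (D.coeff u')) (hv : D.MemX 1 (D.coeff v)) :
    D.bilin lam (u - u') v = D.bilin lam u v - D.bilin lam u' v := by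
  obtain ⟨K, hK⟩ := hD.exists_clm_invSqrtAinv_sqrtC₀
  obtain ⟨x, rfl⟩ := memX_one_iff.1 hu
  obtain ⟨x', rfl⟩ := memX_one_iff.1 hu'
  obtain ⟨y, rfl⟩ := memX_one_iff.1 hv
  simp only [← map_sub, bilin_sqrtC₀, hK]
  rw [map_sub, inner_sub_left, inner_sub_left]
  ring

/-! ### The posterior mean -/

lemma exists_solution_operator (hD : D.Assumptions s₀ β ℓ) {lam : ℝ} (hlam : 0 < lam) :
    ∃ M : H →L[ℝ] H, ∀ h m,
      D.IsPosteriorMean β ℓ lam (D.toScale (2 * β - 2 * ℓ - 1) h) m ↔ m = M h := by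
  obtain ⟨K, hK⟩ := hD.exists_clm_invSqrtAinv_sqrtC₀
  obtain ⟨c, -, hc⟩ := hD.ainvInv_bound
  obtain ⟨T, -, hT⟩ := (hc 1 hD.β_sub_lt_one.le le_rfl).exists_clm graphAinvInv_iff
  obtain ⟨L, hL⟩ := exists_clm_forall_inner_add_mul_inner_eq_iff K hlam
  refine ⟨D.sqrtC₀ ∘L L ∘L T, fun h m => ?_⟩
  have hweak (x : H) : (∀ v, D.MemX 1 (D.coeff v) →
      D.bilin lam (D.sqrtC₀ x) v = pairing (D.toScale (-1) (T h)) (D.coeff v)) ↔ x = L (T h) := by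
    simp only [memX_one_iff, forall_exists_index, forall_apply_eq_imp_iff, bilin_sqrtC₀, hK,
      coeff_sqrtC₀, pairing_toScale, hL]
  simp only [IsPosteriorMean, hT, exists_eq_left]
  constructor
  · rintro ⟨hm, hmv⟩
    obtain ⟨x, rfl⟩ := memX_one_iff.1 hm
    rw [(hweak x).1 hmv, ContinuousLinearMap.comp_apply, ContinuousLinearMap.comp_apply]
  · rintro rfl
    exact ⟨memX_one_iff.2 ⟨_, rfl⟩, (hweak _).2 rfl⟩

lemma existsUnique_isPosteriorMean (hD : D.Assumptions s₀ β ℓ) {lam : ℝ} (hlam : 0 < lam)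
    {y : ℕ → ℝ} (hy : D.MemX (2 * β - 2 * ℓ - 1) y) : ∃! m, D.IsPosteriorMean β ℓ lam y m := by
  obtain ⟨M, hM⟩ := hD.exists_solution_operator hlam
  obtain ⟨h, rfl⟩ := memX_iff.1 hy
  simp only [hM, existsUnique_eq]

lemma memX_data (hD : D.Assumptions s₀ β ℓ) {u : H} (hu : D.MemX (β - 2 * ℓ) (D.coeff u)) (n : ℝ)
    {ξ : ℕ → ℝ} (hξ : D.MemX (2 * β - 2 * ℓ - 1) ξ) :
    D.MemX (2 * β - 2 * ℓ - 1) (D.data u n ξ) := by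
  obtain ⟨r, hr, -⟩ := hD.exists_isExtValue_Ainv hu
  exact hr.1.add (hξ.smul _)

/-! ### The error bound -/

lemma exists_energy_le (hD : D.Assumptions s₀ β ℓ) :
    ∃ C : ℝ≥0, ∀ lam e, 0 ≤ lam → D.MemX 1 (D.coeff e) →
      D.energy (β - 2 * ℓ) lam (D.coeff e) ≤ C * ‖D.bilin lam e e‖ₑ := by
  obtain ⟨c, _, hc, -, h⟩ := hD.equiv
  refine ⟨c⁻¹ ^ 2 + 1, fun lam e hlam he => ?_⟩
  obtain ⟨w, hw, hle, -⟩ := h e (he.mono hD.β_sub_lt_one.le)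
  have hp : D.scaleNorm (β - 2 * ℓ) (D.coeff e) ≤ c⁻¹ * ‖w‖ₑ := by
    calc D.scaleNorm (β - 2 * ℓ) (D.coeff e)
        = (c⁻¹ : ℝ≥0) * (c * D.scaleNorm (β - 2 * ℓ) (D.coeff e)) := by
          rw [← mul_assoc, ← ENNReal.coe_mul, inv_mul_cancel₀ hc.ne', ENNReal.coe_one, one_mul]
      _ ≤ (c⁻¹ : ℝ≥0) * ‖w‖ₑ := by gcongr
  have hp_sq := pow_le_pow_left₀ zero_le hp 2
  rw [mul_pow] at hp_sq
  rw [enorm_bilin_self hlam he, invSqrtAinv_eq hw, energy, mul_add]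
  push_cast
  exact add_le_add (hp_sq.trans (mul_le_mul_left le_self_add _))
    (le_mul_of_one_le_left zero_le le_add_self)

lemma bilin_error (hD : D.Assumptions s₀ β ℓ) {lam n : ℝ} {u m v : H} {ξ r : ℕ → ℝ}
    (hu : D.MemX 1 (D.coeff u)) (hm : D.IsPosteriorMean β ℓ lam (D.data u n ξ) m)
    (hr : D.IsExtValue D.graphAinvInv (2 * β - 2 * ℓ - 1) (-1) ξ r) (hv : D.MemX 1 (D.coeff v)) :
    D.bilin lam (m - u) v =
      (√n)⁻¹ * pairing r (D.coeff v) - lam * pairing (D.pow (-1) (D.coeff u)) (D.coeff v) := by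
  obtain ⟨c, -, hc⟩ := hD.ainvInv_bound
  obtain ⟨r', hr', hr'v⟩ := hD.exists_isExtValue_Ainv (hu.mono hD.β_sub_lt_one.le)
  obtain ⟨hm₁, r'', hr'', hmv⟩ := hm
  have hsum : r'' = r' + (√n)⁻¹ • r :=
    (hc 1 hD.β_sub_lt_one.le le_rfl).eq_add_smul_of_isExtValue graphAinvInv_iff hr' hr hr''
  rw [hD.bilin_sub_left lam hm₁ hu hv, hmv v hv, hsum,
    pairing_add_smul_left hr'.2.1 hr.2.1 hv, hr'v v hv, bilin, pairing_pow]
  ring_nf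

lemma exists_enorm_bilin_error_le (hD : D.Assumptions s₀ β ℓ) :
    ∃ c : ℝ≥0, ∀ (η₁ η₂ lam n : ℝ) (u m v : H) (ξ : ℕ → ℝ), β - 2 * ℓ ≤ η₁ → η₁ ≤ 1 → η₂ ≤ 1 →
      0 ≤ lam → D.MemX (2 * β - 2 * ℓ - η₁) ξ → D.MemX (2 - η₂) (D.coeff u) →
      D.IsPosteriorMean β ℓ lam (D.data u n ξ) m → D.MemX 1 (D.coeff v) →
      ‖D.bilin lam (m - u) v‖ₑ ≤
        c * (ENNReal.ofReal (√n)⁻¹ * D.scaleNorm (2 * β - 2 * ℓ - η₁) ξ) *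
            D.scaleNorm η₁ (D.coeff v) +
          c * (ENNReal.ofReal lam * D.scaleNorm (2 - η₂) (D.coeff u)) *
            D.scaleNorm η₂ (D.coeff v) := by
  obtain ⟨c, -, hc⟩ := hD.ainvInv_bound
  refine ⟨c + 1, fun η₁ η₂ lam n u m v ξ hη₁ hη₁' hη₂ hlam hξ hu hm hv => ?_⟩
  obtain ⟨r, hr, hrc⟩ := (hc η₁ hη₁ hη₁').exists_isExtValue graphAinvInv_iff hξ
  have hpow : D.scaleNorm (-η₂) (D.pow (-1) (D.coeff u)) = D.scaleNorm (2 - η₂) (D.coeff u) := by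
    rw [scaleNorm_pow]
    ring_nf
  have hnoise : ‖pairing r (D.coeff v)‖ₑ ≤
      ↑(c + 1) * D.scaleNorm (2 * β - 2 * ℓ - η₁) ξ * D.scaleNorm η₁ (D.coeff v) := by
    refine (enorm_pairing_le hr.2.1 (hv.mono hη₁')).trans (mul_le_mul_left (hrc.trans ?_) _)
    gcongr
    exact le_self_add
  have hprior : ‖pairing (D.pow (-1) (D.coeff u)) (D.coeff v)‖ₑ ≤
      ↑(c + 1) * D.scaleNorm (2 - η₂) (D.coeff u) * D.scaleNorm η₂ (D.coeff v) := by
    rw [← hpow, mul_assoc]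
    exact (enorm_pairing_le (hpow.trans_lt hu) (hv.mono hη₂)).trans
      (le_mul_of_one_le_left zero_le (by simp))
  rw [hD.bilin_error (hu.mono (by linarith)) hm (hr.mono (by linarith) (neg_le_neg hη₁')) hv]
  refine enorm_sub_le.trans ?_
  rw [enorm_mul, enorm_mul, Real.enorm_of_nonneg hlam,
    Real.enorm_of_nonneg (inv_nonneg.2 (Real.sqrt_nonneg n)),
    mul_left_comm _ (ENNReal.ofReal (√n)⁻¹), mul_left_comm _ (ENNReal.ofReal lam),
    mul_assoc (ENNReal.ofReal (√n)⁻¹), mul_assoc (ENNReal.ofReal lam)]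
  gcongr

lemma eta_mem_Icc (hD : D.Assumptions s₀ β ℓ) {θ : ℝ} (hθ : θ ∈ Set.Icc (0 : ℝ) 1) :
    eta β ℓ θ ∈ Set.Icc (β - 2 * ℓ) 1 := by
  have h := hD.β_sub_lt_one
  rw [eta]
  constructor <;> nlinarith [hθ.1, hθ.2]

lemma exists_energy_error_le (hD : D.Assumptions s₀ β ℓ) :
    ∃ C : ℝ≥0, ∀ (θ₁ θ₂ lam n : ℝ) (u m : H) (ξ : ℕ → ℝ), θ₁ ∈ Set.Icc (0 : ℝ) 1 →
      θ₂ ∈ Set.Icc (0 : ℝ) 1 → 0 < lam → 0 < n → D.MemX (2 * β - 2 * ℓ - eta β ℓ θ₁) ξ →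
      D.MemX (2 - eta β ℓ θ₂) (D.coeff u) → D.IsPosteriorMean β ℓ lam (D.data u n ξ) m →
      D.energy (β - 2 * ℓ) lam (D.coeff (m - u)) ≤
        C * (ENNReal.ofReal (n⁻¹ * lam ^ (-θ₁)) * D.scaleNorm (2 * β - 2 * ℓ - eta β ℓ θ₁) ξ ^ 2 +
          ENNReal.ofReal (lam ^ (2 - θ₂)) * D.scaleNorm (2 - eta β ℓ θ₂) (D.coeff u) ^ 2) := by
  obtain ⟨C, hC⟩ := hD.exists_energy_le
  obtain ⟨c, hc⟩ := hD.exists_enorm_bilin_error_le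
  refine ⟨2 * (C * c) ^ 2, fun θ₁ θ₂ lam n u m ξ hθ₁ hθ₂ hlam hn hξ hu hm => ?_⟩
  obtain ⟨hη₁, hη₁'⟩ := hD.eta_mem_Icc hθ₁
  obtain ⟨-, hη₂⟩ := hD.eta_mem_Icc hθ₂
  have he : D.MemX 1 (D.coeff (m - u)) := by
    rw [coeff_sub]
    exact hm.1.sub (hu.mono (by linarith))
  have hbound := (hC lam (m - u) hlam.le he).trans
    (mul_le_mul_right (hc _ _ lam n u m (m - u) ξ hη₁ hη₁' hη₂ hlam.le hξ hu hm he) _)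
  rw [mul_add, ← mul_assoc _ _ (D.scaleNorm (eta β ℓ θ₁) _),
    ← mul_assoc _ _ (D.scaleNorm (eta β ℓ θ₂) _)] at hbound
  refine (le_of_le_mul_add_mul_of_sq_le (energy_ne_top hD.β_sub_lt_one.le he) hbound
    (scaleNorm_eta_sq_le β ℓ hθ₁ hlam _) (scaleNorm_eta_sq_le β ℓ hθ₂ hlam _)).trans ?_
  rw [ENNReal.ofReal_mul (by positivity), ← ofReal_inv_sqrt_sq hn.le, ← ofReal_sq_mul_rpow_neg hlam]
  push_cast
  exact le_of_eq (by ring)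

lemma exists_scaleNorm_error_sq_le (hD : D.Assumptions s₀ β ℓ) :
    ∃ C : ℝ≥0, ∀ (θ₁ θ₂ n : ℝ) (u m : H) (ξ : ℕ → ℝ), θ₁ ∈ Set.Icc (0 : ℝ) 1 →
      θ₂ ∈ Set.Icc (0 : ℝ) 1 → 0 < n → D.MemX (2 * β - 2 * ℓ - eta β ℓ θ₁) ξ →
      D.MemX (2 - eta β ℓ θ₂) (D.coeff u) →
      D.IsPosteriorMean β ℓ (1 / (n * tau θ₁ θ₂ n ^ 2)) (D.data u n ξ) m →
      ∀ θ ∈ Set.Icc (0 : ℝ) 1, D.scaleNorm (eta β ℓ θ) (D.coeff (m - u)) ^ 2 ≤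
        C * ENNReal.ofReal (n ^ ((θ + θ₂ - 2) / (θ₁ - θ₂ + 2))) *
          max (D.scaleNorm (2 * β - 2 * ℓ - eta β ℓ θ₁) ξ)
            (D.scaleNorm (2 - eta β ℓ θ₂) (D.coeff u)) ^ 2 := by
  obtain ⟨C, hC⟩ := hD.exists_energy_error_le
  refine ⟨2 * C, fun θ₁ θ₂ n u m ξ hθ₁ hθ₂ hn hξ hu hm θ hθ => ?_⟩
  have hd : θ₁ - θ₂ + 2 ≠ 0 := by linarith [hθ₁.1, hθ₂.2]
  rw [one_div_mul_tau_sq hd hn] at hm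
  set lam := n ^ (-1 / (θ₁ - θ₂ + 2)) with hlam_def
  have hlam : 0 < lam := Real.rpow_pos_of_pos hn _
  have henergy := hC θ₁ θ₂ lam n u m ξ hθ₁ hθ₂ hlam hn hξ hu hm
  rw [inv_mul_rpow_neg_eq hd hn hlam_def] at henergy
  set X := D.scaleNorm (2 * β - 2 * ℓ - eta β ℓ θ₁) ξ
  set U := D.scaleNorm (2 - eta β ℓ θ₂) (D.coeff u)
  calc D.scaleNorm (eta β ℓ θ) (D.coeff (m - u)) ^ 2
      ≤ ENNReal.ofReal (lam ^ (-θ)) * D.energy (β - 2 * ℓ) lam (D.coeff (m - u)) :=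
        scaleNorm_eta_sq_le β ℓ hθ hlam _
    _ ≤ ENNReal.ofReal (lam ^ (-θ)) * (C * (ENNReal.ofReal (lam ^ (2 - θ₂)) * max X U ^ 2 +
          ENNReal.ofReal (lam ^ (2 - θ₂)) * max X U ^ 2)) := by
        refine mul_le_mul_right (henergy.trans ?_) _
        gcongr
        exacts [le_max_left X U, le_max_right X U]
    _ = 2 * C * (ENNReal.ofReal (lam ^ (-θ)) * ENNReal.ofReal (lam ^ (2 - θ₂))) *
          max X U ^ 2 := by ring
    _ = _ := by
        rw [← ENNReal.ofReal_mul (by positivity), rpow_neg_mul_rpow_eq hd hn hlam_def]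
        push_cast
        rfl

end Assumptions

/-! ### Measurability -/

variable (D) in
lemma measurable_scaleNorm (t : ℝ) : Measurable (D.scaleNorm t) := by
  unfold scaleNorm pow
  fun_prop

variable (D) in
lemma measurable_data (u : H) (n : ℝ) : Measurable (D.data u n) := by
  unfold data
  fun_prop

section Measurability

variable {Ω : Type*} [MeasurableSpace Ω] {P : Measure Ω} {y : Ω → ℕ → ℝ}

lemma exists_aestronglyMeasurable_toScale (hy : AEMeasurable y P) {t : ℝ}
    (ht : ∀ᵐ ω ∂P, D.MemX t (y ω)) :
    ∃ X : Ω → H, AEStronglyMeasurable X P ∧ ∀ᵐ ω ∂P, D.toScale t (X ω) = y ω := by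
  have hexists (ω : Ω) : ∃ x, D.MemX t (y ω) → D.toScale t x = y ω := by
    by_cases hω : D.MemX t (y ω)
    · exact (memX_iff.1 hω).imp fun _ hx _ => hx
    · exact ⟨0, fun h => absurd h hω⟩
  choose X hX using hexists
  have hXy : ∀ᵐ ω ∂P, D.toScale t (X ω) = y ω := ht.mono hX
  refine ⟨X, aestronglyMeasurable_of_tendsto_ae atTop
    (f := fun N ω => ∑ k ∈ Finset.range N, D.pow (-t / 2) (y ω) k • D.φ k) (fun N => ?_) ?_, hXy⟩
  · refine Finset.aestronglyMeasurable_fun_sum _ fun k _ => ?_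
    have hk : AEMeasurable (fun ω => y ω k) P := (measurable_pi_apply k).comp_aemeasurable hy
    exact (hk.const_mul (D.σ k ^ (-t / 2))).aestronglyMeasurable.smul_const (D.φ k)
  · filter_upwards [hXy] with ω hω
    rw [← hω, pow_neg_toScale]
    simpa only [repr_apply] using (D.φ.hasSum_repr (X ω)).tendsto_sum_nat

lemma Assumptions.aestronglyMeasurable_posteriorMean {s₀ β ℓ lam : ℝ}
    (hD : D.Assumptions s₀ β ℓ) (hlam : 0 < lam) (hy : AEMeasurable y P) {m : Ω → H}
    (hm : ∀ᵐ ω ∂P, D.IsPosteriorMean β ℓ lam (y ω) (m ω)) : AEStronglyMeasurable m P := by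
  obtain ⟨M, hM⟩ := hD.exists_solution_operator hlam
  have hy_mem : ∀ᵐ ω ∂P, D.MemX (2 * β - 2 * ℓ - 1) (y ω) := by
    filter_upwards [hm] with ω hω
    obtain ⟨-, r, hr, -⟩ := hω
    exact hr.1
  obtain ⟨X, hX, hXy⟩ := exists_aestronglyMeasurable_toScale hy hy_mem
  refine (M.continuous.comp_aestronglyMeasurable hX).congr ?_
  filter_upwards [hXy, hm] with ω hω hmω
  rw [← hω, hM] at hmω
  exact hmω.symm

lemma ae_memX_of_lintegral_max_sq_lt_top (hy : AEMeasurable y P) {s t : ℝ} {a : ℕ → ℝ}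
    (h : ∫⁻ ω, max (D.scaleNorm s (y ω)) (D.scaleNorm t a) ^ 2 ∂P < ∞) :
    ∀ᵐ ω ∂P, D.MemX s (y ω) ∧ D.MemX t a := by
  have hs := (D.measurable_scaleNorm s).comp_aemeasurable hy
  filter_upwards [ae_lt_top' ((hs.max aemeasurable_const).pow_const 2) h.ne] with ω hω
  exact max_lt_iff.1 ((ENNReal.pow_lt_top_iff).1 hω |>.resolve_right two_ne_zero)

end Measurability

end Model

end BayesInv

theorem theorem7p1_general {H : Type*} [NormedAddCommGroup H] [InnerProductSpace ℝ H]
    [CompleteSpace H] (D : BayesInv.Model H) (s₀ β ℓ : ℝ) (hD : D.Assumptions s₀ β ℓ)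
    {Ω : Type*} [MeasurableSpace Ω] (P : Measure Ω) (ξ : Ω → ℕ → ℝ) (hξ : AEMeasurable ξ P) (u : H)
    (θ₁ θ₂ : ℝ) (hθ₁ : θ₁ ∈ Set.Icc (0 : ℝ) 1) (hθ₂ : θ₂ ∈ Set.Icc (0 : ℝ) 1)
    (hκ : ∫⁻ ω, (max (D.scaleNorm (2 * β - 2 * ℓ - BayesInv.eta β ℓ θ₁) (ξ ω))
      (D.scaleNorm (2 - BayesInv.eta β ℓ θ₂) (D.coeff u))) ^ 2 ∂P < ∞) :
    ∃ c : ℝ, 0 < c ∧ ∀ n lam : ℝ, 0 < n → lam = 1 / (n * BayesInv.tau θ₁ θ₂ n ^ 2) →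
      (∀ᵐ ω ∂P, ∃! m : H, D.IsPosteriorMean β ℓ lam (D.data u n (ξ ω)) m) ∧
      ∀ m : Ω → H, (∀ᵐ ω ∂P, D.IsPosteriorMean β ℓ lam (D.data u n (ξ ω)) (m ω)) →
        AEStronglyMeasurable m P ∧
        ∀ θ ∈ Set.Icc (0 : ℝ) 1,
          ∫⁻ ω, D.scaleNorm (BayesInv.eta β ℓ θ) (D.coeff (m ω - u)) ^ 2 ∂P ≤
            ENNReal.ofReal (c * n ^ ((θ + θ₂ - 2) / (θ₁ - θ₂ + 2))) := by
  obtain ⟨C, hC⟩ := hD.exists_scaleNorm_error_sq_le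
  obtain ⟨c, hc, hCc⟩ := BayesInv.exists_pos_le_ofReal
    (ENNReal.mul_lt_top (ENNReal.coe_lt_top (r := C)) hκ).ne
  have hmem := BayesInv.Model.ae_memX_of_lintegral_max_sq_lt_top hξ hκ
  refine ⟨c, hc, fun n lam hn hlam => ?_⟩
  have hlam₀ : 0 < lam := hlam ▸ BayesInv.one_div_mul_tau_sq_pos θ₁ θ₂ hn
  refine ⟨?_, fun m hm => ⟨?_, fun θ hθ => ?_⟩⟩
  · filter_upwards [hmem] with ω ⟨hξω, hu⟩
    exact hD.existsUnique_isPosteriorMean hlam₀ (hD.memX_data (hu.mono (by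
      linarith [(hD.eta_mem_Icc hθ₂).2, hD.β_sub_lt_one])) n
      (hξω.mono (by linarith [(hD.eta_mem_Icc hθ₁).2])))
  · exact hD.aestronglyMeasurable_posteriorMean hlam₀
      ((D.measurable_data u n).comp_aemeasurable hξ) hm
  · have hle := (hmem.and hm).mono fun ω h =>
      hC θ₁ θ₂ n u (m ω) (ξ ω) hθ₁ hθ₂ hn h.1.1 h.1.2 (hlam ▸ h.2) θ hθ
    refine (lintegral_mono_ae hle).trans ?_
    rw [lintegral_const_mul' _ _ (by finiteness), mul_right_comm, ENNReal.ofReal_mul hc.le]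
    exact mul_le_mul_left hCc _

theorem theorem7p1 {H : Type*} [NormedAddCommGroup H] [InnerProductSpace ℝ H] [CompleteSpace H]
    (D : BayesInv.Model H) (s₀ β ℓ : ℝ) (hD : D.Assumptions s₀ β ℓ)
    {Ω : Type*} [MeasurableSpace Ω] (P : Measure Ω) [IsProbabilityMeasure P]
    (ξ : Ω → ℕ → ℝ) (hξ : D.IsNoise P ξ)
    (u : H) (hu : D.MemX 1 (D.coeff u))
    (θ₁ θ₂ : ℝ) (hθ₁ : θ₁ ∈ Set.Icc (0 : ℝ) 1) (hθ₂ : θ₂ ∈ Set.Icc (0 : ℝ) 1)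
    (hκ : ∫⁻ ω, (max (D.scaleNorm (2 * β - 2 * ℓ - BayesInv.eta β ℓ θ₁) (ξ ω))
      (D.scaleNorm (2 - BayesInv.eta β ℓ θ₂) (D.coeff u))) ^ 2 ∂P < ∞) :
    ∃ c : ℝ, 0 < c ∧ ∀ n lam : ℝ, 0 < n → lam = 1 / (n * BayesInv.tau θ₁ θ₂ n ^ 2) →
      (∀ᵐ ω ∂P, ∃! m : H, D.IsPosteriorMean β ℓ lam (D.data u n (ξ ω)) m) ∧
      ∀ m : Ω → H, (∀ᵐ ω ∂P, D.IsPosteriorMean β ℓ lam (D.data u n (ξ ω)) (m ω)) →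
        AEStronglyMeasurable m P ∧
        ∀ θ ∈ Set.Icc (0 : ℝ) 1,
          ∫⁻ ω, D.scaleNorm (BayesInv.eta β ℓ θ) (D.coeff (m ω - u)) ^ 2 ∂P ≤
            ENNReal.ofReal (c * n ^ ((θ + θ₂ - 2) / (θ₁ - θ₂ + 2))) := by
  exact theorem7p1_general D s₀ β ℓ hD P ξ hξ.measurable.aemeasurable u θ₁ θ₂ hθ₁ hθ₂ hκ
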